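/- Let $G=(V,E)$ be a finite simple graph. The ML degree of the (centred) Gaussian graphical model with graph $G$ is the number of complex solutions of its likelihood equations for generic data, that is, the number $d$ such that for a generic symmetric matrix $S$ (all complex symmetric $S$, in particular all real ones, outside the zero set of some nonzero polynomial in the entries of $S$) there are exactly $d$ invertible complex symmetric matrices $\Sigma\in\mathbb{C}^{V\times V}$ with $$\Sigma_{ij}=S_{ij}\ \text{ whenever } i=j \text{ or } \{i,j\}\in E,\qquad (\Sigma^{-1})_{ij}=0\ \text{ whenever } i\neq j \text{ and } \{i,j\}\notin E.$$ **Theorem.** For every $m\ge 2$, the ML degree of the Gaussian graphical model on the complete bipartite graph $K_{2,m}$ is $2m+1$. -/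

import Mathlib

/-- The symmetric complex matrix with free entries `s e`, one for each unordered pair `e` of
indices. As `s` varies, this runs through all symmetric matrices exactly once. -/
def symMatrix {V : Type*} (s : Sym2 V → ℂ) : Matrix V V ℂ :=
  Matrix.of fun i j => s s(i, j)

/-- The complex solutions `Σ` of the likelihood equations of the (centred) Gaussian graphical model
with graph `G` for the sample covariance matrix `S`: the invertible symmetric matrices that agree
with `S` on the diagonal and on the edges of `G`, and whose inverse vanishes at the non-edges
of `G`. (The positive definite solution, if there is one, is the maximum likelihood estimate.) -/
def likelihoodSolutions {V : Type*} [Fintype V] [DecidableEq V] (G : SimpleGraph V)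
    (S : Matrix V V ℂ) : Set (Matrix V V ℂ) :=
  {M | M.IsSymm ∧ IsUnit M.det ∧
    (∀ i j, i = j ∨ G.Adj i j → M i j = S i j) ∧
    (∀ i j, i ≠ j → ¬ G.Adj i j → M⁻¹ i j = 0)}

/-- `d` is the ML degree of the Gaussian graphical model with graph `G`: for a generic symmetric
matrix `S` (outside the zero set of some nonzero polynomial in the entries of `S`) the
likelihood equations have exactly `d` distinct complex solutions. -/
def IsMLDegree {V : Type*} [Fintype V] [DecidableEq V] (G : SimpleGraph V) (d : ℕ) : Prop :=
  ∃ P : MvPolynomial (Sym2 V) ℂ, P ≠ 0 ∧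
    ∀ s : Sym2 V → ℂ, MvPolynomial.eval s P ≠ 0 →
      (likelihoodSolutions G (symMatrix s)).encard = d

/-- The ML degree is well defined: there is at most one such number. -/
theorem IsMLDegree.unique {V : Type*} [Fintype V] [DecidableEq V] {G : SimpleGraph V} {d e : ℕ}
    (hd : IsMLDegree G d) (he : IsMLDegree G e) : d = e := by
  obtain ⟨P, hP, hPd⟩ := hd
  obtain ⟨Q, hQ, hQe⟩ := he
  have hne : ∃ s : Sym2 V → ℂ, MvPolynomial.eval s (P * Q) ≠ 0 := by
    by_contra! h
    exact mul_ne_zero hP hQ (MvPolynomial.funext fun s => by simpa using h s)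
  obtain ⟨s, hs⟩ := hne
  rw [map_mul] at hs
  have h1 := hPd s (left_ne_zero_of_mul hs)
  have h2 := hQe s (right_ne_zero_of_mul hs)
  exact_mod_cast h1.symm.trans h2

/-! Let `A = !![α, x; x, β]` be the block of `Σ` on the part of size two, `q = det A`, and `cᵢ =
(aᵢ, bᵢ)`. The zeros of `Σ⁻¹` in the large part force `Σₖₗ = cₖᵀ A⁻¹ cₗ` for `k ≠ l`, so `x`
determines `Σ`. With `gᵢ/q` the conditional variances and `(yᵢ, zᵢ) = q A⁻¹ cᵢ`, the one remaining
condition is `x = ∑ yᵢ zᵢ / gᵢ`. Clearing denominators gives `scorePoly`, of degree `2m + 1` with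
leading coefficient `∏ (-wᵢ)`.

Solutions correspond to roots once `A` singular is excluded
(`eq_candidate_of_mem_likelihoodSolutions`) and the roots are simple and avoid the zeros of `q` and
`gᵢ`. The latter is coprimality with `avoidPoly`, an open condition by resultants
(`exists_isCoprime_generic`), so one explicit point suffices (`exists_isCoprime_scorePoly`). For `m
= 1` it fails: the score polynomial is then `q (w x - a b)`. -/

open Polynomial Finset

/-! ### The score polynomial: specialization, degree and roots -/

section ScorePolynomial

variable {R : Type*} [CommRing R] {ι : Type*} [Fintype ι] [DecidableEq ι]

/-- With `q = α β - x²` the determinant of the upper left block `A = !![α, x; x, β]`, this is `q`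
times the conditional variance `w - cᵀ A⁻¹ c` with `c = (a, b)`, as a polynomial in `x`. -/
noncomputable def condVarPoly (α β a b w : R) : R[X] :=
  C w * (C (α * β) - X ^ 2) - (C (β * a ^ 2) - C (2 * a * b) * X + C (α * b ^ 2))

/-- The product of the two coordinates of `q A⁻¹ c`, as a polynomial in `x`. -/
noncomputable def crossPoly (α β a b : R) : R[X] :=
  (C (β * a) - C b * X) * (C (α * b) - C a * X)

/-- The polynomial in `x` whose roots are the values of the unknown covariance of the two
vertices of the first part, for a Gaussian graphical model on `K_{2,m}`. -/
noncomputable def scorePoly (α β : R) (a b w : ι → R) : R[X] :=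
  X * ∏ i, condVarPoly α β (a i) (b i) (w i) -
    ∑ i, crossPoly α β (a i) (b i) * ∏ j ∈ univ.erase i, condVarPoly α β (a j) (b j) (w j)

/-- The polynomial whose roots the score polynomial has to avoid. -/
noncomputable def avoidPoly (α β : R) (a b w : ι → R) : R[X] :=
  derivative (scorePoly α β a b w) * (C (α * β) - X ^ 2) *
    ∏ i, condVarPoly α β (a i) (b i) (w i)

section map
variable {S : Type*} [CommRing S] (φ : R →+* S)

lemma condVarPoly_map (α β a b w : R) :
    (condVarPoly α β a b w).map φ = condVarPoly (φ α) (φ β) (φ a) (φ b) (φ w) := by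
  simp only [condVarPoly, Polynomial.map_sub, Polynomial.map_add, Polynomial.map_mul,
    Polynomial.map_pow, map_C, map_X, map_mul, map_pow, map_ofNat, Polynomial.map_ofNat]

lemma crossPoly_map (α β a b : R) :
    (crossPoly α β a b).map φ = crossPoly (φ α) (φ β) (φ a) (φ b) := by
  simp [crossPoly]

lemma scorePoly_map (α β : R) (a b w : ι → R) :
    (scorePoly α β a b w).map φ =
      scorePoly (φ α) (φ β) (fun i => φ (a i)) (fun i => φ (b i)) (fun i => φ (w i)) := by
  simp [scorePoly, Polynomial.map_sum, Polynomial.map_prod, condVarPoly_map, crossPoly_map]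

lemma avoidPoly_map (α β : R) (a b w : ι → R) :
    (avoidPoly α β a b w).map φ =
      avoidPoly (φ α) (φ β) (fun i => φ (a i)) (fun i => φ (b i)) (fun i => φ (w i)) := by
  simp [avoidPoly, Polynomial.map_prod, condVarPoly_map, ← scorePoly_map, derivative_map]

end map

lemma condVarPoly_natDegree_le (α β a b w : R) : (condVarPoly α β a b w).natDegree ≤ 2 := by
  unfold condVarPoly; compute_degree

lemma condVarPoly_coeff_two (α β a b w : R) : (condVarPoly α β a b w).coeff 2 = -w := by
  simp only [condVarPoly, coeff_sub, coeff_add, coeff_C_mul, coeff_X_pow, coeff_X, coeff_C]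
  simp

lemma crossPoly_natDegree_le (α β a b : R) : (crossPoly α β a b).natDegree ≤ 2 := by
  unfold crossPoly; compute_degree

lemma prod_condVarPoly_natDegree_le {κ : Type*} (s : Finset κ) (α β : R) (a b w : κ → R) :
    (∏ i ∈ s, condVarPoly α β (a i) (b i) (w i)).natDegree ≤ 2 * #s := by
  refine (natDegree_prod_le _ _).trans ?_
  rw [mul_comm, ← smul_eq_mul]
  exact sum_le_card_nsmul _ _ _ fun i _ => condVarPoly_natDegree_le ..

lemma scoreSum_natDegree_le (α β : R) (a b w : ι → R) :
    (∑ i, crossPoly α β (a i) (b i) *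
      ∏ j ∈ univ.erase i, condVarPoly α β (a j) (b j) (w j)).natDegree ≤ 2 * Fintype.card ι := by
  refine natDegree_sum_le_of_forall_le _ _ fun i _ => natDegree_mul_le.trans ?_
  have h1 := crossPoly_natDegree_le α β (a i) (b i)
  have h2 := prod_condVarPoly_natDegree_le (univ.erase i) α β a b w
  have h3 := card_erase_add_one (mem_univ i)
  rw [card_univ] at h3
  lia

lemma scorePoly_natDegree_le (α β : R) (a b w : ι → R) :
    (scorePoly α β a b w).natDegree ≤ 2 * Fintype.card ι + 1 := by
  refine (natDegree_sub_le _ _).trans (max_le ?_ ?_)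
  · refine natDegree_mul_le.trans ?_
    have h1 := natDegree_X_le (R := R)
    have h2 := prod_condVarPoly_natDegree_le univ α β a b w
    rw [card_univ] at h2
    lia
  · exact (scoreSum_natDegree_le ..).trans (Nat.le_succ _)

/-- Only `X * ∏ gᵢ` reaches this degree. The coefficient involves `w` alone, so the degree survives
any specialization with all `wᵢ ≠ 0`. -/
lemma scorePoly_coeff (α β : R) (a b w : ι → R) :
    (scorePoly α β a b w).coeff (2 * Fintype.card ι + 1) = ∏ i, -w i := by
  rw [scorePoly, coeff_sub, coeff_X_mul,
    coeff_eq_zero_of_natDegree_lt (Nat.lt_succ_of_le (scoreSum_natDegree_le ..)), sub_zero,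
    mul_comm, ← card_univ,
    coeff_prod_of_natDegree_le _ _ _ fun i _ => condVarPoly_natDegree_le ..]
  exact prod_congr rfl fun i _ => condVarPoly_coeff_two ..

lemma scorePoly_natDegree [IsDomain R] (α β : R) (a b : ι → R) {w : ι → R} (hw : ∀ i, w i ≠ 0) :
    (scorePoly α β a b w).natDegree = 2 * Fintype.card ι + 1 := by
  refine natDegree_eq_of_le_of_coeff_ne_zero (scorePoly_natDegree_le ..) ?_
  rw [scorePoly_coeff]
  exact prod_ne_zero_iff.2 fun i _ => neg_ne_zero.2 (hw i)

lemma eval_condVarPoly (α β a b w x : R) : (condVarPoly α β a b w).eval x =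
    w * (α * β - x ^ 2) - (β * a ^ 2 - 2 * a * b * x + α * b ^ 2) := by
  simp [condVarPoly]

lemma eval_crossPoly (α β a b x : R) : (crossPoly α β a b).eval x =
    (β * a - b * x) * (α * b - a * x) := by
  simp [crossPoly]

end ScorePolynomial

/-- Away from the zeros of the `gᵢ`, the factor `∏ gᵢ` can be divided out. -/
lemma scorePoly_isRoot_iff {F : Type*} [Field F] {ι : Type*} [Fintype ι] [DecidableEq ι]
    {α β x : F} {a b w : ι → F} (hg : ∀ i, (condVarPoly α β (a i) (b i) (w i)).eval x ≠ 0) :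
    (scorePoly α β a b w).IsRoot x ↔
      ∑ i, (crossPoly α β (a i) (b i)).eval x / (condVarPoly α β (a i) (b i) (w i)).eval x
        = x := by
  have key : (scorePoly α β a b w).eval x =
      (∏ i, (condVarPoly α β (a i) (b i) (w i)).eval x) * (x -
      ∑ i, (crossPoly α β (a i) (b i)).eval x / (condVarPoly α β (a i) (b i) (w i)).eval x) := by
    simp only [scorePoly, eval_sub, eval_mul, eval_X, eval_prod, eval_finsetSum, mul_sub, mul_sum]
    congr 1
    · ring
    · refine sum_congr rfl fun i _ => ?_
      rw [← mul_prod_erase univ _ (mem_univ i)]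
      field_simp [hg i]
  rw [IsRoot, key, mul_eq_zero, or_iff_right (prod_ne_zero_iff.2 fun i _ => hg i), sub_eq_zero,
    eq_comm]

/-! ### Genericity of coprimality -/

/-- Coprimality of two specialized polynomials is a generic condition if it holds at one point at
which the degree of the first polynomial does not drop. -/
lemma exists_isCoprime_generic {σ F : Type*} [Field F] (p g : (MvPolynomial σ F)[X])
    (s₀ : σ → F) (hdeg : (p.map (MvPolynomial.eval s₀)).natDegree = p.natDegree)
    (hpos : p.natDegree ≠ 0)
    (h : IsCoprime (p.map (MvPolynomial.eval s₀)) (g.map (MvPolynomial.eval s₀))) :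
    ∃ D : MvPolynomial σ F, MvPolynomial.eval s₀ D ≠ 0 ∧ ∀ s, MvPolynomial.eval s D ≠ 0 →
      IsCoprime (p.map (MvPolynomial.eval s)) (g.map (MvPolynomial.eval s)) := by
  refine ⟨resultant p g, ?_, fun s hs => ?_⟩
  · rw [← resultant_map_map, ← hdeg]
    -- The degree of `g` may drop by `k` at `s₀`; up to sign this only multiplies the resultant by
    -- the `k`-th power of the leading coefficient of the specialized `p`.
    obtain ⟨k, hk⟩ := Nat.exists_eq_add_of_le
      (natDegree_map_le (p := g) (f := MvPolynomial.eval s₀))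
    rw [hk, resultant_add_right_deg _ _ _ _ _ le_rfl]
    refine mul_ne_zero (pow_ne_zero _ ?_) (resultant_ne_zero _ _ h)
    rw [coeff_natDegree, leadingCoeff_ne_zero]
    rintro h0
    rw [h0, natDegree_zero] at hdeg
    exact hpos hdeg.symm
  · obtain ⟨u, v, -, -, e⟩ := exists_mul_add_mul_eq_C_resultant p g le_rfl le_rfl (.inl hpos)
    have e' := congrArg (Polynomial.map (MvPolynomial.eval s)) e
    simp only [Polynomial.map_add, Polynomial.map_mul, map_C] at e'
    refine ⟨C (MvPolynomial.eval s (resultant p g))⁻¹ * u.map (MvPolynomial.eval s),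
      C (MvPolynomial.eval s (resultant p g))⁻¹ * v.map (MvPolynomial.eval s), ?_⟩
    rw [mul_assoc, mul_assoc, ← mul_add, mul_comm (u.map _), mul_comm (v.map _), e', ← C_mul,
      inv_mul_cancel₀ hs, C_1]

/-! ### Solutions of the likelihood equations and roots of the score polynomial -/

section Solutions

variable {ι : Type*} [DecidableEq ι]

lemma mem_likelihoodSolutions_completeBipartite [Fintype ι] {S M : Matrix (Fin 2 ⊕ ι) (Fin 2 ⊕ ι) ℂ} :
    M ∈ likelihoodSolutions (completeBipartiteGraph (Fin 2) ι) S ↔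
      M.IsSymm ∧ IsUnit M.det ∧
      ((∀ i, M i i = S i i) ∧ (∀ u k, M (.inl u) (.inr k) = S (.inl u) (.inr k)) ∧
        ∀ u k, M (.inr k) (.inl u) = S (.inr k) (.inl u)) ∧
      (M⁻¹ (.inl 0) (.inl 1) = 0 ∧ M⁻¹ (.inl 1) (.inl 0) = 0 ∧
        ∀ k l, k ≠ l → M⁻¹ (.inr k) (.inr l) = 0) := by
  simp only [likelihoodSolutions, Set.mem_ofPred_eq]
  refine and_congr_right fun _ => and_congr_right fun _ => and_congr ?_ ?_
  · constructor
    · intro h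
      exact ⟨fun i => h i i (.inl rfl), fun u k => h _ _ (.inr (by simp)),
        fun u k => h _ _ (.inr (by simp))⟩
    · rintro ⟨h1, h2, h3⟩ i j (rfl | h)
      · exact h1 i
      · rcases i with i | i <;> rcases j with j | j <;> simp at h
        · exact h2 i j
        · exact h3 j i
  · constructor
    · intro h
      exact ⟨h _ _ (by simp) (by simp), h _ _ (by simp) (by simp),
        fun k l hkl => h _ _ (by simpa using hkl) (by simp)⟩
    · rintro ⟨h1, h2, h3⟩ (i | i) (j | j) hij h
      · fin_cases i <;> fin_cases j <;> simp at hij ⊢ <;> assumption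
      · simp at h
      · simp at h
      · exact h3 i j (by simpa using hij)

/-- The candidate solution with the value `x` at the non-edge of the first part. -/
noncomputable def candidate (α β : ℂ) (a b w : ι → ℂ) (x : ℂ) :
    Matrix (Fin 2 ⊕ ι) (Fin 2 ⊕ ι) ℂ :=
  Matrix.fromBlocks !![α, x; x, β] (Matrix.of ![a, b]) (Matrix.of ![a, b]).transpose
    (Matrix.of fun k l => if k = l then w k else
      (β * a k * a l - x * (a k * b l + a l * b k) + α * b k * b l) / (α * β - x ^ 2))

/-- The inverse of the candidate solution. -/
noncomputable def candidateInv [Fintype ι] (α β : ℂ) (a b w : ι → ℂ) (x : ℂ) :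
    Matrix (Fin 2 ⊕ ι) (Fin 2 ⊕ ι) ℂ :=
  let q := α * β - x ^ 2
  let y := fun i => β * a i - b i * x
  let z := fun i => α * b i - a i * x
  let g := fun i => (condVarPoly α β (a i) (b i) (w i)).eval x
  Matrix.fromBlocks !![β / q + ∑ i, y i ^ 2 / (g i * q), 0; 0, α / q + ∑ i, z i ^ 2 / (g i * q)]
    (Matrix.of ![fun i => - (y i / g i), fun i => - (z i / g i)])
    (Matrix.of ![fun i => - (y i / g i), fun i => - (z i / g i)]).transpose
    (Matrix.diagonal fun i => q / g i)

variable {α β x : ℂ} {a b w : ι → ℂ}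

/-- One formula on and off the diagonal: a rank-two part `cₖᵀ A⁻¹ cₗ` plus the diagonal matrix of
conditional variances. -/
lemma candidate_inr_inr (hq : α * β - x ^ 2 ≠ 0) (k l : ι) :
    candidate α β a b w x (.inr k) (.inr l) =
      (a k * (β * a l - b l * x) + b k * (α * b l - a l * x)) / (α * β - x ^ 2) +
      if k = l then (condVarPoly α β (a l) (b l) (w l)).eval x / (α * β - x ^ 2) else 0 := by
  simp only [candidate, Matrix.fromBlocks_apply₂₂, Matrix.of_apply]
  split_ifs with h
  · subst h
    rw [eval_condVarPoly, ← add_div, eq_div_iff hq]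
    ring
  · rw [add_zero]
    congr 1
    ring

lemma candidate_isSymm : (candidate α β a b w x).IsSymm := by
  refine Matrix.IsSymm.fromBlocks ?_ rfl ?_
  · ext i j
    fin_cases i <;> fin_cases j <;> rfl
  · ext k l
    simp only [Matrix.transpose_apply, Matrix.of_apply]
    by_cases h : k = l
    · subst h; rfl
    · rw [if_neg h, if_neg (Ne.symm h)]
      congr 1
      ring

/-- Shape of the entries of `Σ Σ⁻¹` in the first two columns: the summands combine to multiples of
`Hᵢ = yᵢ zᵢ / gᵢ`, whose sum is `t = x` by the score equation. -/
lemma mul_add_sum_add_sum {κ R : Type*} [Fintype κ] [CommSemiring R] {c d e t : R} {Y U H : κ → R}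
    (hH : ∑ i, H i = t) (h : ∀ i, c * Y i + U i = e * H i) :
    c * (d + ∑ i, Y i) + ∑ i, U i = c * d + e * t := by
  rw [mul_add, add_assoc, mul_sum, ← sum_add_distrib, sum_congr rfl fun i _ => h i, ← mul_sum, hH]

variable [Fintype ι]

/-- By the Schur complement, the upper left block of the inverse is `A⁻¹ + ∑ (q/gᵢ) A⁻¹ cᵢ cᵢᵀ A⁻¹`.
Its off-diagonal entry `(-x + ∑ yᵢ zᵢ / gᵢ) / q` vanishes exactly by the score equation. -/
lemma candidate_mul_candidateInv (hq : α * β - x ^ 2 ≠ 0)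
    (hg : ∀ i, (condVarPoly α β (a i) (b i) (w i)).eval x ≠ 0)
    (hx : (scorePoly α β a b w).IsRoot x) :
    candidate α β a b w x * candidateInv α β a b w x = 1 := by
  rw [scorePoly_isRoot_iff hg] at hx
  simp only [eval_crossPoly] at hx
  have hM := candidate_inr_inr (a := a) (b := b) (w := w) hq
  obtain ⟨q, hqd⟩ : ∃ q, q = α * β - x ^ 2 := ⟨_, rfl⟩
  rw [← hqd] at hq hM
  ext (u | k) (v | l) <;>
    rw [Matrix.mul_apply, Fintype.sum_sum_type, Fin.sum_univ_two]
  · fin_cases u <;> fin_cases v <;> simp only [candidate, candidateInv,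
      Matrix.fromBlocks_apply₁₁, Matrix.fromBlocks_apply₁₂, Matrix.fromBlocks_apply₂₁,
      Matrix.of_apply, Matrix.cons_val', Matrix.cons_val_zero, Matrix.cons_val_one,
      Matrix.transpose_apply, Fin.zero_eta, Fin.mk_one, Matrix.cons_val_fin_one, mul_zero,
      add_zero, zero_add, ← hqd]
    · rw [mul_add_sum_add_sum (e := -x / q) hx
        fun i => by have := hg i; field_simp; rw [hqd]; ring, Matrix.one_apply_eq]
      field_simp
      rw [hqd]
      ring
    · rw [mul_add_sum_add_sum (e := -α / q) hx
        fun i => by have := hg i; field_simp; rw [hqd]; ring, Matrix.one_apply_ne (by simp)]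
      ring
    · rw [mul_add_sum_add_sum (e := -β / q) hx
        fun i => by have := hg i; field_simp; rw [hqd]; ring, Matrix.one_apply_ne (by simp)]
      ring
    · rw [mul_add_sum_add_sum (e := -x / q) hx
        fun i => by have := hg i; field_simp; rw [hqd]; ring, Matrix.one_apply_eq]
      field_simp
      rw [hqd]
      ring
  · have hl := hg l
    fin_cases u <;> simp [candidate, candidateInv, Matrix.diagonal_apply, ← hqd] <;>
      field_simp <;> rw [hqd] <;> ring
  -- The diagonal part of the lower right block contributes the single term `y k / q`.
  · have hsplit : ∀ y : ι → ℂ, ∑ i, candidate α β a b w x (.inr k) (.inr i) *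
        -(y i / (condVarPoly α β (a i) (b i) (w i)).eval x) =
        ∑ i, (a k * (β * a i - b i * x) + b k * (α * b i - a i * x)) / q *
          -(y i / (condVarPoly α β (a i) (b i) (w i)).eval x) - y k / q := by
      intro y
      simp only [hM, add_mul, sum_add_distrib, ite_mul, zero_mul, sum_ite_eq, mem_univ, if_true]
      have := hg k
      rw [sub_eq_add_neg]
      congr 1
      field_simp
    have hK : ∀ i v, candidateInv α β a b w x (.inr i) (.inl v) =
        -(![fun i => β * a i - b i * x, fun i => α * b i - a i * x] v i /
          (condVarPoly α β (a i) (b i) (w i)).eval x) := by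
      intro i v
      fin_cases v <;> simp [candidateInv]
    simp only [hK, hsplit]
    fin_cases v <;> simp only [candidate, candidateInv,
      Matrix.fromBlocks_apply₁₁, Matrix.fromBlocks_apply₂₁,
      Matrix.of_apply, Matrix.cons_val', Matrix.cons_val_zero, Matrix.cons_val_one,
      Matrix.transpose_apply, Fin.zero_eta, Fin.mk_one, Matrix.cons_val_fin_one, mul_zero,
      add_zero, zero_add, ← hqd]
    · rw [← add_sub_assoc, mul_add_sum_add_sum (e := -b k / q) hx
        fun i => by have := hg i; field_simp; ring, Matrix.one_apply_ne (by simp)]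
      ring
    · rw [← add_sub_assoc, mul_add_sum_add_sum (e := -a k / q) hx
        fun i => by have := hg i; field_simp; ring, Matrix.one_apply_ne (by simp)]
      ring
  · have hl := hg l
    simp only [hM]
    simp only [candidate, candidateInv]
    simp [Matrix.diagonal_apply, Matrix.one_apply, ← hqd]
    split_ifs <;> field_simp <;> ring

lemma candidate_mem_likelihoodSolutions {S : Matrix (Fin 2 ⊕ ι) (Fin 2 ⊕ ι) ℂ} (hS : S.IsSymm)
    (hα : S (.inl 0) (.inl 0) = α) (hβ : S (.inl 1) (.inl 1) = β)
    (ha : ∀ k, S (.inl 0) (.inr k) = a k) (hb : ∀ k, S (.inl 1) (.inr k) = b k)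
    (hw : ∀ k, S (.inr k) (.inr k) = w k) (hq : α * β - x ^ 2 ≠ 0)
    (hg : ∀ i, (condVarPoly α β (a i) (b i) (w i)).eval x ≠ 0)
    (hx : (scorePoly α β a b w).IsRoot x) :
    candidate α β a b w x ∈ likelihoodSolutions (completeBipartiteGraph (Fin 2) ι) S := by
  have h1 := candidate_mul_candidateInv hq hg hx
  rw [mem_likelihoodSolutions_completeBipartite, Matrix.inv_eq_right_inv h1]
  have hedge : ∀ u k, candidate α β a b w x (.inl u) (.inr k) = S (.inl u) (.inr k) := by
    intro u k
    fin_cases u <;> simp [candidate, ha, hb]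
  refine ⟨candidate_isSymm, Matrix.isUnit_det_of_right_inverse h1, ⟨?_, hedge, ?_⟩, ?_, ?_, ?_⟩
  · rintro (u | k)
    · fin_cases u <;> simp [candidate, hα, hβ]
    · simp [candidate, hw]
  · intro u k
    rw [← candidate_isSymm.apply, hedge, hS.apply]
  · simp [candidateInv]
  · simp [candidateInv]
  · intro k l hkl
    simp [candidateInv, hkl]

/-- Column `l` of `M * M⁻¹ = 1` has a single unknown `v l` from the large part. If `q ≠ 0`, Cramer's
rule expresses the column through `v l`, which gives `v l = q / gₗ` and the entries of `M`; the
column of the second vertex gives the score equation. -/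
lemma eq_candidate_of_mem_likelihoodSolutions {S M : Matrix (Fin 2 ⊕ ι) (Fin 2 ⊕ ι) ℂ}
    [Nontrivial ι]
    (hα : S (.inl 0) (.inl 0) = α) (hβ : S (.inl 1) (.inl 1) = β)
    (ha : ∀ k, S (.inl 0) (.inr k) = a k) (hb : ∀ k, S (.inl 1) (.inr k) = b k)
    (hw : ∀ k, S (.inr k) (.inr k) = w k)
    (hα0 : α ≠ 0) (hβ0 : β ≠ 0) (hE : ∀ k, α * b k ^ 2 - β * a k ^ 2 ≠ 0)
    (hM : M ∈ likelihoodSolutions (completeBipartiteGraph (Fin 2) ι) S) :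
    ∃ x, (scorePoly α β a b w).IsRoot x ∧ M = candidate α β a b w x := by
  rw [mem_likelihoodSolutions_completeBipartite] at hM
  obtain ⟨hsymm, hdet, ⟨hdiag, hedge, -⟩, h01, h10, hoff⟩ := hM
  have hinv := Matrix.mul_nonsing_inv M hdet
  generalize hx : M (.inl 0) (.inl 1) = x
  have hx' : M (.inl 1) (.inl 0) = x := by rw [← hx, hsymm.apply]
  have hMa : ∀ k, M (.inl 0) (.inr k) = a k := fun k => by rw [hedge, ha]
  have hMb : ∀ k, M (.inl 1) (.inr k) = b k := fun k => by rw [hedge, hb]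
  have hMa' : ∀ k, M (.inr k) (.inl 0) = a k := fun k => by rw [← hMa k, hsymm.apply]
  have hMb' : ∀ k, M (.inr k) (.inl 1) = b k := fun k => by rw [← hMb k, hsymm.apply]
  have hM0 : M (.inl 0) (.inl 0) = α := by rw [hdiag, hα]
  have hM1 : M (.inl 1) (.inl 1) = β := by rw [hdiag, hβ]
  have hMw : ∀ k, M (.inr k) (.inr k) = w k := fun k => by rw [hdiag, hw]
  have hKsymm : (M⁻¹).IsSymm := by
    rw [Matrix.IsSymm, Matrix.transpose_nonsing_inv, hsymm.eq]
  generalize M⁻¹ = K at hinv h01 h10 hoff hKsymm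
  have hent : ∀ i j, ∑ k, M i k * K k j = (1 : Matrix _ _ ℂ) i j := fun i j => by
    rw [← hinv, Matrix.mul_apply]
  simp only [Fintype.sum_sum_type, Fin.sum_univ_two] at hent
  have hsingle : ∀ i l, ∑ k, M i (.inr k) * K (.inr k) (.inr l) =
      M i (.inr l) * K (.inr l) (.inr l) := fun i l =>
    sum_eq_single l (fun k _ hk => by rw [hoff k l hk, mul_zero]) (by simp)
  have e0 : ∀ l, α * K (.inl 0) (.inr l) + x * K (.inl 1) (.inr l) +
      a l * K (.inr l) (.inr l) = 0 := fun l => by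
    have h := hent (.inl 0) (.inr l)
    rw [hsingle] at h
    simpa [hM0, hx, hMa] using h
  have e1 : ∀ l, x * K (.inl 0) (.inr l) + β * K (.inl 1) (.inr l) +
      b l * K (.inr l) (.inr l) = 0 := fun l => by
    have h := hent (.inl 1) (.inr l)
    rw [hsingle] at h
    simpa [hM1, hx', hMb] using h
  have e2 : ∀ k l, a k * K (.inl 0) (.inr l) + b k * K (.inl 1) (.inr l) +
      M (.inr k) (.inr l) * K (.inr l) (.inr l) = if k = l then 1 else 0 := fun k l => by
    have h := hent (.inr k) (.inr l)
    rw [hsingle] at h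
    simpa [hMa', hMb', Matrix.one_apply] using h
  have f0 : x * K (.inl 1) (.inl 1) + ∑ k, a k * K (.inl 1) (.inr k) = 0 := by
    simpa [h01, hx, hMa, hKsymm.apply (.inl 1)] using hent (.inl 0) (.inl 1)
  have f1 : β * K (.inl 1) (.inl 1) + ∑ k, b k * K (.inl 1) (.inr k) = 1 := by
    simpa [h01, hM1, hMb, hKsymm.apply (.inl 1)] using hent (.inl 1) (.inl 1)
  clear hent hsingle hinv hoff hdet h10 h01 hKsymm
  generalize K (.inl 1) (.inl 1) = d at f0 f1
  generalize hp : (fun l => K (.inl 0) (.inr l)) = p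
  generalize hr : (fun l => K (.inl 1) (.inr l)) = r
  generalize hv : (fun l => K (.inr l) (.inr l)) = v
  replace hp : ∀ l, K (.inl 0) (.inr l) = p l := fun l => congrFun hp l
  replace hr : ∀ l, K (.inl 1) (.inr l) = r l := fun l => congrFun hr l
  replace hv : ∀ l, K (.inr l) (.inr l) = v l := fun l => congrFun hv l
  simp only [hp, hr, hv] at e0 e1 e2 f0 f1
  by_cases hq : α * β - x ^ 2 = 0
  -- If `A` is singular, Cramer's rule forces `v l = 0`. Then `(p l, r l)` is orthogonal to `(α, x)`
  -- and, for a second index `k ≠ l`, to `(aₖ, bₖ)`. These are independent by `hE`, so column `l` of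
  -- the inverse is zero. Two indices are needed here.
  · exfalso
    obtain ⟨k, l, hkl⟩ := exists_pair_ne ι
    have hy : β * a l - b l * x ≠ 0 := fun h =>
      mul_ne_zero hβ0 (hE l) (by linear_combination b l ^ 2 * hq - (β * a l + b l * x) * h)
    have hz : α * b k - a k * x ≠ 0 := fun h =>
      mul_ne_zero hα0 (hE k) (by linear_combination (α * b k + a k * x) * h - a k ^ 2 * hq)
    have hvl : v l = 0 := by
      refine (mul_eq_zero.1 (?_ : (β * a l - b l * x) * v l = 0)).resolve_left hy
      linear_combination β * e0 l - x * e1 l - p l * hq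
    have hkl' := e2 k l
    have hll := e2 l l
    have hl0 := e0 l
    rw [if_neg hkl] at hkl'
    rw [if_pos rfl] at hll
    rw [hvl, mul_zero, add_zero] at hkl' hll hl0
    have hrl : r l = 0 := by
      refine (mul_eq_zero.1 (?_ : (α * b k - a k * x) * r l = 0)).resolve_left hz
      linear_combination α * hkl' - a k * hl0
    rw [hrl, mul_zero, add_zero] at hll hl0
    rw [(mul_eq_zero.1 hl0).resolve_left hα0, mul_zero] at hll
    exact zero_ne_one hll
  · have hqp : ∀ l, (α * β - x ^ 2) * p l = -((β * a l - b l * x) * v l) := fun l => by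
      linear_combination β * e0 l - x * e1 l
    have hqr : ∀ l, (α * β - x ^ 2) * r l = -((α * b l - a l * x) * v l) := fun l => by
      linear_combination α * e1 l - x * e0 l
    have hvg : ∀ l, v l * (condVarPoly α β (a l) (b l) (w l)).eval x = α * β - x ^ 2 := fun l => by
      have h := e2 l l
      rw [if_pos rfl, hMw] at h
      rw [eval_condVarPoly]
      linear_combination (α * β - x ^ 2) * h - a l * hqp l - b l * hqr l
    have hv0 : ∀ l, v l ≠ 0 := fun l h => hq (by rw [← hvg l, h, zero_mul])
    have hg : ∀ l, (condVarPoly α β (a l) (b l) (w l)).eval x ≠ 0 := fun l h =>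
      hq (by rw [← hvg l, h, mul_zero])
    refine ⟨x, ?_, ?_⟩
    · rw [scorePoly_isRoot_iff hg]
      have hterm : ∀ i, (crossPoly α β (a i) (b i)).eval x /
          (condVarPoly α β (a i) (b i) (w i)).eval x =
          x * (b i * r i) - β * (a i * r i) := fun i => by
        rw [div_eq_iff (hg i), eval_crossPoly]
        refine mul_left_cancel₀ hq ?_
        linear_combination (β * a i - b i * x) * (α * b i - a i * x) * -hvg i +
          (β * a i - b i * x) * (condVarPoly α β (a i) (b i) (w i)).eval x * hqr i
      rw [sum_congr rfl fun i _ => hterm i, sum_sub_distrib, ← mul_sum, ← mul_sum]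
      -- This combination eliminates the unknown diagonal entry `d`.
      linear_combination x * f1 - β * f0
    · ext (i | k) (j | l)
      · fin_cases i <;> fin_cases j <;> simp [candidate, hM0, hM1, hx, hx']
      · fin_cases i <;> simp [candidate, hMa, hMb]
      · fin_cases j <;> simp [candidate, hMa', hMb']
      · by_cases hkl : k = l
        · subst hkl
          simp [candidate, hMw]
        · simp only [candidate, Matrix.fromBlocks_apply₂₂, Matrix.of_apply, if_neg hkl]
          have h := e2 k l
          rw [if_neg hkl] at h
          rw [eq_div_iff hq]
          refine mul_right_cancel₀ (hv0 l) ?_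
          linear_combination (α * β - x ^ 2) * h - a k * hqp l - b k * hqr l

/-- The solutions of the likelihood equations are parametrized by the roots of the score
polynomial. -/
theorem encard_likelihoodSolutions_completeBipartite [Nontrivial ι]
    {S : Matrix (Fin 2 ⊕ ι) (Fin 2 ⊕ ι) ℂ} (hS : S.IsSymm)
    (hα : S (.inl 0) (.inl 0) = α) (hβ : S (.inl 1) (.inl 1) = β)
    (ha : ∀ k, S (.inl 0) (.inr k) = a k) (hb : ∀ k, S (.inl 1) (.inr k) = b k)
    (hw : ∀ k, S (.inr k) (.inr k) = w k)
    (hα0 : α ≠ 0) (hβ0 : β ≠ 0) (hw0 : ∀ k, w k ≠ 0)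
    (hE : ∀ k, α * b k ^ 2 - β * a k ^ 2 ≠ 0)
    (hcop : IsCoprime (scorePoly α β a b w) (avoidPoly α β a b w)) :
    (likelihoodSolutions (completeBipartiteGraph (Fin 2) ι) S).encard =
      (2 * Fintype.card ι + 1 : ℕ) := by
  have hdeg := scorePoly_natDegree α β a b hw0
  have hne : scorePoly α β a b w ≠ 0 := by
    rintro h
    rw [h, natDegree_zero] at hdeg
    lia
  have himage : likelihoodSolutions (completeBipartiteGraph (Fin 2) ι) S =
      candidate α β a b w '' ((scorePoly α β a b w).roots.toFinset : Set ℂ) := by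
    ext M
    simp only [Set.mem_image, mem_coe, Multiset.mem_toFinset, mem_roots hne]
    constructor
    · intro h
      obtain ⟨x, hx, rfl⟩ :=
        eq_candidate_of_mem_likelihoodSolutions hα hβ ha hb hw hα0 hβ0 hE h
      exact ⟨x, hx, rfl⟩
    · rintro ⟨x, hx, rfl⟩
      have h := ((isCoprime_iff_aeval_ne_zero_of_isAlgClosed ℂ ℂ _ _).1 hcop x).resolve_left
        (not_not.2 (by simpa using hx))
      simp only [avoidPoly, coe_aeval_eq_eval, eval_mul, eval_prod] at h
      refine candidate_mem_likelihoodSolutions hS hα hβ ha hb hw ?_ ?_ hx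
      · simpa using right_ne_zero_of_mul (left_ne_zero_of_mul h)
      · exact fun i => prod_ne_zero_iff.1 (right_ne_zero_of_mul h) i (mem_univ i)
  have hinj : Function.Injective (candidate α β a b w) := fun x y h => by
    simpa [candidate] using congrFun (congrFun h (.inl 0)) (.inl 1)
  have hsep : (scorePoly α β a b w).Separable :=
    (hcop.of_mul_right_left).of_mul_right_left
  rw [himage, hinj.encard_image, Set.encard_coe_eq_coe_finsetCard,
    Multiset.toFinset_card_of_nodup (nodup_roots hsep),
    ← (IsAlgClosed.splits _).natDegree_eq_card_roots, hdeg]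

end Solutions

/-! ### An explicit point where coprimality holds -/

/-- If `p` enumerates the roots of `X ^ m - c`, then the symmetric functions in the score
polynomial can be evaluated in closed form. -/
lemma prod_sub_add_sum_mul_prod_erase {F ι : Type*} [Field F] [Fintype ι] [DecidableEq ι] {c : F}
    {p : ι → F} (hp : ∏ i, (X - C (p i)) = X ^ Fintype.card ι - C c) (u : F) :
    ∏ i, (u - p i) + ∑ i, p i * ∏ j ∈ univ.erase i, (u - p j) =
      u ^ Fintype.card ι + c * (Fintype.card ι - 1) := by
  have h1 : ∏ i, (u - p i) = u ^ Fintype.card ι - c := by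
    simpa [eval_prod] using congrArg (eval u) hp
  have h2 : u * ∑ i, ∏ j ∈ univ.erase i, (u - p j) = Fintype.card ι * u ^ Fintype.card ι := by
    have h := congrArg (fun f => u * eval u (derivative f)) hp
    simp only [derivative_prod_finset, derivative_X, mul_one, eval_finsetSum, eval_prod, eval_sub,
      eval_X, eval_C, derivative_sub, derivative_X_pow, derivative_C, sub_zero, eval_mul,
      eval_pow, map_natCast, eval_natCast] at h
    rw [h]
    rcases Nat.eq_zero_or_pos (Fintype.card ι) with h0 | h0
    · simp [h0]
    · rw [mul_left_comm, mul_pow_sub_one h0.ne']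
  -- Write `p i = u - (u - p i)`, which reduces the sum to the derivative of the product.
  have h3 : ∀ i, p i * ∏ j ∈ univ.erase i, (u - p j) =
      u * ∏ j ∈ univ.erase i, (u - p j) - ∏ j, (u - p j) := fun i => by
    rw [← mul_prod_erase univ (fun j => u - p j) (mem_univ i)]
    ring
  rw [sum_congr rfl fun i _ => h3 i, sum_sub_distrib, ← mul_sum, h2, sum_const, card_univ,
    nsmul_eq_mul, h1]
  ring

lemma exists_prod_X_sub_C_eq (m : ℕ) (hm : m ≠ 0) {c : ℂ} :
    ∃ p : Fin m → ℂ, ∏ i, (X - C (p i)) = X ^ m - C c := by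
  obtain ⟨r, hr⟩ := IsAlgClosed.exists_pow_nat_eq c (Nat.pos_of_ne_zero hm)
  refine ⟨fun i => Complex.exp (2 * Real.pi * Complex.I / m) ^ (i : ℕ) * r, ?_⟩
  rw [X_pow_sub_C_eq_prod (Complex.isPrimitiveRoot_exp m hm) (Nat.pos_of_ne_zero hm) hr,
    ← Fin.prod_univ_eq_prod_range
      (fun i => X - C (Complex.exp (2 * Real.pi * Complex.I / m) ^ i * r))]

/-- There is a star-like specialization for which the score polynomial is
`X * ((1 - X ^ 2) ^ m + 2 * (m - 1))`. -/
lemma exists_isCoprime_scorePoly (m : ℕ) (hm : 2 ≤ m) :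
    ∃ a : Fin m → ℂ, (∀ i, a i ≠ 0) ∧
      IsCoprime (scorePoly 1 1 a 0 1) (avoidPoly 1 1 a 0 1) := by
  -- The `aᵢ²` will be the `m`-th roots of `c = 2`. With `c = 1` some `gᵢ = 1 - x² - aᵢ²` would
  -- vanish at the root `x = 0`.
  obtain ⟨p, hp⟩ := exists_prod_X_sub_C_eq m (by lia) (c := 2)
  have hpm : ∀ i, p i ^ m = 2 := fun i => by
    have h := congrArg (eval (p i)) hp
    rw [eval_prod, prod_eq_zero (mem_univ i) (by simp)] at h
    simp only [eval_sub, eval_pow, eval_X, eval_C] at h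
    exact (sub_eq_zero.1 h.symm)
  choose a ha using fun i => IsAlgClosed.exists_pow_nat_eq (p i) (n := 2) two_pos
  have hm1 : (m : ℂ) - 1 ≠ 0 := sub_ne_zero.2 (by norm_cast; lia)
  have hm0 : (m : ℂ) ≠ 0 := by norm_cast; lia
  have hg : ∀ i x, (condVarPoly 1 1 (a i) 0 1).eval x = (1 - x ^ 2) - p i := fun i x => by
    rw [eval_condVarPoly, ← ha]
    ring
  have hscore : scorePoly 1 1 a 0 1 = X * ((1 - X ^ 2) ^ m + C (2 * ((m : ℂ) - 1))) := by
    refine Polynomial.funext fun x => ?_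
    have h := prod_sub_add_sum_mul_prod_erase (c := (2 : ℂ)) (p := p)
      (by rw [hp, Fintype.card_fin]) (1 - x ^ 2)
    rw [Fintype.card_fin] at h
    simp only [scorePoly, Pi.zero_apply, Pi.one_apply, eval_sub, eval_mul, eval_X, eval_prod, hg,
      eval_finsetSum, eval_crossPoly, eval_add, eval_pow, eval_one, eval_C]
    rw [← h, mul_add, sub_eq_add_neg, mul_sum, ← sum_neg_distrib]
    congr 1
    refine sum_congr rfl fun i _ => ?_
    rw [← ha]
    ring
  refine ⟨a, fun i h => ?_, ?_⟩
  · have h1 := hpm i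
    rw [← ha, h, zero_pow two_ne_zero, zero_pow (by lia)] at h1
    exact two_ne_zero h1.symm
  rw [isCoprime_iff_aeval_ne_zero_of_isAlgClosed ℂ ℂ]
  intro x
  rw [or_iff_not_imp_left, not_not, avoidPoly, hscore]
  simp only [coe_aeval_eq_eval, eval_mul, eval_add, eval_sub, eval_pow, eval_one, eval_X, eval_C, derivative_mul,
    derivative_X, derivative_add, derivative_C, derivative_pow, derivative_sub, derivative_one,
    eval_prod, Pi.zero_apply, Pi.one_apply, hg, eval_zero]
  intro hx
  replace hx := mul_eq_zero.1 hx
  have hu : x ≠ 0 → (1 - x ^ 2) ^ m = -(2 * ((m : ℂ) - 1)) := fun h =>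
    eq_neg_of_add_eq_zero_left (hx.resolve_left h)
  have hu0 : x ≠ 0 → 1 - x ^ 2 ≠ 0 := fun h h0 => by
    have h1 := hu h
    rw [h0, zero_pow (by lia)] at h1
    simp [hm1] at h1
  -- Put `u = 1 - x²`. At `x = 0` the derivative is `2m - 1` and `u = 1`. At the other roots `u ^ m
  -- = -2(m - 1)`, which is neither `0` nor `2`, the derivative being `-2 m x² u ^ (m - 1)`.
  refine mul_ne_zero (mul_ne_zero ?_ ?_) (prod_ne_zero_iff.2 fun i _ hi => ?_)
  · by_cases h : x = 0
    · intro h1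
      have h2 : 2 * (m : ℂ) = 1 := by
        simp [h] at h1
        linear_combination h1
      norm_cast at h2
      lia
    · rw [hu h]
      simp [h, hm0, hu0 h]
  · by_cases h : x = 0
    · simp [h]
    · simpa using hu0 h
  · have h1 := hpm i
    rw [← sub_eq_zero.1 hi] at h1
    by_cases h : x = 0
    · simp [h] at h1
    · rw [hu h] at h1
      apply hm0
      linear_combination (-1 / 2 : ℂ) * h1

/-! ### The ML degree -/

theorem theorem4p3 (m : ℕ) (hm : 2 ≤ m) :
    IsMLDegree (completeBipartiteGraph (Fin 2) (Fin m)) (2 * m + 1) := by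
  have : Nontrivial (Fin m) := Fin.nontrivial_iff_two_le.2 hm
  obtain ⟨a, ha0, hcop⟩ := exists_isCoprime_scorePoly m hm
  let v : Fin 2 ⊕ Fin m → Fin 2 ⊕ Fin m → MvPolynomial (Sym2 (Fin 2 ⊕ Fin m)) ℂ :=
    fun i j => MvPolynomial.X s(i, j)
  let entry : Fin 2 ⊕ Fin m → Fin 2 ⊕ Fin m → ℂ := fun i j =>
    Sum.elim (fun u => Sum.elim (fun v => if u = v then 1 else 0)
      (fun k => if u = 0 then a k else 0) j)
      (fun k => Sum.elim (fun v => if v = 0 then a k else 0) (fun l => if k = l then 1 else 0) j) i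
  have hentry : ∀ i j, entry i j = entry j i := by
    rintro (i | i) (j | j) <;> simp [entry, eq_comm]
  let s₀ : Sym2 (Fin 2 ⊕ Fin m) → ℂ := Sym2.lift ⟨entry, hentry⟩
  let α := v (.inl 0) (.inl 0)
  let β := v (.inl 1) (.inl 1)
  let A := fun k => v (.inl 0) (.inr k)
  let B := fun k => v (.inl 1) (.inr k)
  let W := fun k => v (.inr k) (.inr k)
  have hs₀ : ∀ i j, MvPolynomial.eval s₀ (v i j) = entry i j := fun i j => by
    simp [v, s₀]
  have hp₀ : (scorePoly α β A B W).map (MvPolynomial.eval s₀) = scorePoly 1 1 a 0 1 := by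
    rw [scorePoly_map]
    simp only [α, β, A, B, W, hs₀, entry]
    simp [Pi.zero_def, Pi.one_def]
  have hg₀ : (avoidPoly α β A B W).map (MvPolynomial.eval s₀) = avoidPoly 1 1 a 0 1 := by
    rw [avoidPoly_map]
    simp only [α, β, A, B, W, hs₀, entry]
    simp [Pi.zero_def, Pi.one_def]
  have hdeg : (scorePoly α β A B W).natDegree = 2 * m + 1 := by
    rw [scorePoly_natDegree _ _ _ _ fun k => MvPolynomial.X_ne_zero _, Fintype.card_fin]
  obtain ⟨D, hD₀, hD⟩ := exists_isCoprime_generic (scorePoly α β A B W) (avoidPoly α β A B W) s₀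
    (by rw [hp₀, hdeg, scorePoly_natDegree 1 1 a 0 (w := 1) fun _ => one_ne_zero, Fintype.card_fin])
    (by lia) (by rwa [hp₀, hg₀])
  -- The factors are the genericity conditions of the root count; none vanishes at `s₀`, the last
  -- because `αbₖ² - βaₖ²` becomes `-aₖ²`.
  refine ⟨D * (α * β * ∏ k, W k) * ∏ k, (α * B k ^ 2 - β * A k ^ 2), fun h => ?_, fun s hs => ?_⟩
  · have h' := congrArg (MvPolynomial.eval s₀) h
    simp only [map_mul, map_prod, map_sub, map_pow, map_zero, α, β, A, B, W, hs₀] at h'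
    simp [hD₀, entry, ha0, prod_eq_zero_iff] at h'
  · simp only [map_mul, map_prod, map_sub, map_pow, mul_ne_zero_iff, prod_ne_zero_iff] at hs
    obtain ⟨⟨hsD, ⟨hsα, hsβ⟩, hsW⟩, hsE⟩ := hs
    have hcop' := hD s hsD
    rw [scorePoly_map, avoidPoly_map] at hcop'
    rw [encard_likelihoodSolutions_completeBipartite (S := symMatrix s)
      (by ext i j; simp [symMatrix, Sym2.eq_swap]) rfl rfl (fun _ => rfl) (fun _ => rfl)
      (fun _ => rfl) (by simpa [symMatrix, α, v] using hsα) (by simpa [symMatrix, β, v] using hsβ)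
      (fun k => by simpa [symMatrix, W, v] using hsW k (mem_univ k))
      (fun k => by simpa [symMatrix, α, β, A, B, v] using hsE k (mem_univ k))
      (by simpa [symMatrix, α, β, A, B, W, v] using hcop'), Fintype.card_fin]
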